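/- **Setting.** Let $N\ge 3$, let $G\subset \mathbf{SL}_N(\mathbb Z)$ be a torsion-free subgroup of finite index, and let $p_1=2<p_2=3<\cdots$ be the primes in increasing order. Let $k_G\ge 2$ be an index such that $\prod_{i\ge k_G}\mathbf{SL}_N(\widehat{\mathbb Z}_{p_i})$ is contained in the closure $\widehat G$ of $G$ in $\mathbf{SL}_N(\widehat{\mathbb Z})=\prod_{i\ge 1}\mathbf{SL}_N(\widehat{\mathbb Z}_{p_i})$. For each $i\ge k_G$ let $A_{p_i}\subset \mathbf{SL}_N(\mathbb Z/p_i\mathbb Z)$ be a non-trivial subgroup with trivial core (it contains no non-trivial normal subgroup of $\mathbf{SL}_N(\mathbb Z/p_i\mathbb Z)$). Let $$X=\prod_{i\ge k_G}\mathbf{SL}_N(\mathbb Z/p_i\mathbb Z)/A_{p_i}$$ with the product topology of the discrete topologies, let $\Phi_0\colon G\to \mathrm{Homeo}(X)$ be the action in which $g\in G$ acts on the $i$-th coordinate by left multiplication by $g \bmod p_i$, and let $x_0=(eA_{p_i})_i\in X$. **Definitions.** For $U\subset X$ non-empty and clopen, let $\mathcal H_U\subset\mathrm{Homeo}(U)$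 be the group of those homeomorphisms of $U$ that are restrictions of some $\Phi_0(g)$, $g\in G$, with $\Phi_0(g)(U)=U$. The set $U$ is *adapted* if for each $g\in G$ and each open $W\subset U$ with $\Phi_0(g)(W)\subset U$ the map $\Phi_0(g)|_W$ is the restriction to $W$ of an element of $\mathcal H_U$. Closures in $\mathrm{Homeo}(U)$ are taken in the uniform topology. For clopen $V\subset U$ let $\mathcal H_{U,V}$ be the subgroup of those $h\in\mathcal H_U$ with $h(V)=V$. The action is *stable* if each $x\in X$ has an adapted clopen neighbourhood $U$ such that for each adapted $V\subset U$ the restriction homomorphism $\overline{\mathcal H_{U,V}}\to\overline{\mathcal H_V}$ has trivial kernel; otherwise it is *wild*. For $x\in U$ the *discriminant group* $\mathcal D(U,x)$ is the isotropy group of $x$ in $\overline{\mathcal H_U}$. An *adapted neighbourhood basis* at $x$ is a descending sequence $(U_\ell)_{\ell\ge1}$ of adapted clopen sets with $\bigcap_\ell U_\ell=\{x\}$. Two sequences $\{\phi_i\colon A_i\to A_{i+1}\}$ and $\{\psi_i\colon B_i\to B_{i+1}\}$ of surjective group homomorphisms are *tail equivalent* if there are a sequence of surjective group homomorphisms $\tau_i\colon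 C_i\to C_{i+1}$ $(i\ge1)$, strictly increasing sequences of indices $(r_i)$ and $(q_i)$, and isomorphisms $A_{r_i}\cong C_{2i-1}$, $B_{q_i}\cong C_{2i}$ under which $\tau_{2i}\circ\tau_{2i-1}$ and $\tau_{2i+1}\circ\tau_{2i}$ correspond to the compositions $A_{r_i}\to A_{r_{i+1}}$ and $B_{q_i}\to B_{q_{i+1}}$ of the given maps. The *asymptotic discriminant* of the action is the tail equivalence class of the sequence of restriction maps $\mathcal D(U_\ell,x)\to\mathcal D(U_{\ell+1},x)$, for a point $x$ and an adapted neighbourhood basis $(U_\ell)$ at $x$. **Proposition.** $(X,G,\Phi_0)$ is an equicontinuous minimal action on a Cantor space, and it is wild. For $n\ge k_G$ let $$U_n=\prod_{k_G\le i<n}\{eA_{p_i}\}\times\prod_{i\ge n}\mathbf{SL}_N(\mathbb Z/p_i\mathbb Z)/A_{p_i}.$$ The sets $U_n$, $n\ge k_G$, form an adapted neighbourhood basis at $x_0$. The group $$\mathcal D_n=\prod_{i\ge n}A_{p_i},$$ acting on $U_n$ by left multiplication in the coordinates $i\ge n$ and trivially in the others, is isomorphic, as a topological group, to $\mathcal D(U_n,x_0)$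 via this action. Under these isomorphisms the restriction map $\mathcal D(U_n,x_0)\to\mathcal D(U_{n+1},x_0)$ is well defined and surjective, is the projection $$\psi_{n,n+1}\colon \prod_{i\ge n}A_{p_i}\to\prod_{i\ge n+1}A_{p_i},$$ and has kernel isomorphic to $A_{p_n}$. The asymptotic discriminant of the action is the tail equivalence class of the sequence $\{\psi_{n,n+1}\colon\mathcal D_n\to\mathcal D_{n+1}\mid n\ge k_G\}$: adapted neighbourhood bases exist at each $x\in X$, and for each $x\in X$ and each such basis at $x$ the sequence of restriction maps between discriminant groups is well defined, consists of surjections, and is tail equivalent to it. -/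

import Mathlib

open Topology TopologicalSpace

/-! ## The group of homeomorphisms of a compact Hausdorff space -/

section Homeo

variable {Y : Type*} [TopologicalSpace Y]

/-- The topology of uniform convergence on `Homeo(Y)`, for `Y` compact Hausdorff: it is induced
from the compact-open topology of `C(Y, Y)`, which for compact `Y` is the topology of uniform
convergence. -/
instance homeoTopology : TopologicalSpace (Y ≃ₜ Y) :=
  TopologicalSpace.induced (fun h : Y ≃ₜ Y => (h : C(Y, Y))) inferInstance

theorem continuous_homeo_coe : Continuous (fun h : Y ≃ₜ Y => (h : C(Y, Y))) :=
  continuous_induced_dom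

instance homeoTopologicalGroup [CompactSpace Y] [T2Space Y] : IsTopologicalGroup (Y ≃ₜ Y) where
  continuous_mul := by
    refine continuous_induced_rng.2 ?_
    have : Continuous fun p : (Y ≃ₜ Y) × (Y ≃ₜ Y) => (p.1 : C(Y, Y)).comp (p.2 : C(Y, Y)) :=
      (continuous_homeo_coe.comp continuous_fst).compCM (continuous_homeo_coe.comp continuous_snd)
    exact this
  continuous_inv := by
    refine continuous_induced_rng.2 (ContinuousMap.continuous_compactOpen.2 ?_)
    intro K hK O hO
    have h1 : IsOpen {f : C(Y, Y) | Set.MapsTo f Oᶜ Kᶜ} :=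
      ContinuousMap.isOpen_setOfPred_mapsTo hO.isClosed_compl.isCompact hK.isClosed.isOpen_compl
    convert h1.preimage (continuous_homeo_coe (Y := Y)) using 1
    ext h
    constructor
    · intro hm y hy hyK
      apply hy
      have := hm hyK
      change h.symm (h y) ∈ O at this
      simpa using this
    · intro hm y hyK
      change h.symm y ∈ O
      by_contra hc
      have := hm (x := h.symm y) hc
      apply this
      change h (h.symm y) ∈ K
      simpa using hyK

end Homeo

instance clopensCompactSpace {X : Type*} [TopologicalSpace X] [CompactSpace X] (U : Clopens X) :
    CompactSpace U :=
  isCompact_iff_compactSpace.1 U.isClopen.isClosed.isCompact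

/-! ## Equicontinuous minimal Cantor actions, adapted sets, stable and wild actions -/

section Actions

variable {G X : Type*} [Group G] [TopologicalSpace X]

/-- A Cantor space: a non-empty, compact, metrizable, totally disconnected space without isolated
points. -/
def IsCantorSpace (X : Type*) [TopologicalSpace X] : Prop :=
  Nonempty X ∧ CompactSpace X ∧ MetrizableSpace X ∧ TotallyDisconnectedSpace X ∧ PerfectSpace X

/-- Every orbit is dense. -/
def IsMinimalAction (Φ : G →* (X ≃ₜ X)) : Prop :=
  ∀ x : X, Dense (Set.range fun g : G => Φ g x)

/-- Equicontinuity with respect to the unique uniform structure of the compact Hausdorff space `X`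
(equivalently, with respect to any compatible metric). -/
def IsEquicontinuousAction [CompactSpace X] [T2Space X] (Φ : G →* (X ≃ₜ X)) : Prop :=
  letI : UniformSpace X := uniformSpaceOfCompactR1
  UniformEquicontinuous fun (g : G) (x : X) => Φ g x

/-- `𝓗_U`: the group of those homeomorphisms of `U` that are restrictions to `U` of elements of the
action (which then map `U` onto itself). -/
def inducedGroup (Φ : G →* (X ≃ₜ X)) (U : Clopens X) : Subgroup (U ≃ₜ U) where
  carrier := {h | ∃ g : G, ∀ u : U, (h u : X) = Φ g u}
  one_mem' := ⟨1, fun u => by simp⟩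
  mul_mem' := by
    rintro a b ⟨g, hg⟩ ⟨g', hg'⟩
    refine ⟨g * g', fun u => ?_⟩
    have : (a * b) u = a (b u) := rfl
    rw [this, hg, hg', map_mul]
    rfl
  inv_mem' := by
    rintro a ⟨g, hg⟩
    refine ⟨g⁻¹, fun u => ?_⟩
    have h1 : (u : X) = Φ g (a⁻¹ u : U) := by
      rw [← hg]
      exact congrArg Subtype.val (a.apply_symm_apply u).symm
    rw [map_inv, h1]
    exact ((Φ g).symm_apply_apply _).symm

/-- A non-empty clopen set `U` is adapted to the action if the restricted pseudogroup on `U`, whose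
elements are the maps `Φ(g)|W` with `W ⊆ U` open and `Φ(g)(W) ⊆ U`, is induced by a group of
homeomorphisms of `U`; that is, if each such `Φ(g)|W` is the restriction to `W` of an element
of `𝓗_U`. -/
def IsAdapted (Φ : G →* (X ≃ₜ X)) (U : Clopens X) : Prop :=
  (U : Set X).Nonempty ∧
    ∀ (g : G) (W : Set X), IsOpen W → ∀ hWU : W ⊆ U, (∀ w ∈ W, Φ g w ∈ U) →
      ∃ h ∈ inducedGroup Φ U, ∀ (w : X) (hw : w ∈ W), (h ⟨w, hWU hw⟩ : X) = Φ g w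

/-- `𝓗_{U,V}`: the subgroup of those elements of `𝓗_U` that map `V` onto itself (for `V ⊆ U`). -/
def inducedStabilizer (Φ : G →* (X ≃ₜ X)) (U V : Clopens X) : Subgroup (U ≃ₜ U) where
  carrier := {h | h ∈ inducedGroup Φ U ∧ ∀ u : U, (h u : X) ∈ V ↔ (u : X) ∈ V}
  one_mem' := ⟨one_mem _, fun _ => Iff.rfl⟩
  mul_mem' := fun {a b} ha hb =>
    ⟨mul_mem ha.1 hb.1, fun u => (ha.2 (b u)).trans (hb.2 u)⟩
  inv_mem' := by
    intro a ha
    refine ⟨inv_mem ha.1, fun u => ?_⟩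
    have h1 : a (a⁻¹ u) = u := a.apply_symm_apply u
    have h2 := ha.2 (a⁻¹ u)
    rw [h1] at h2
    exact h2.symm

/-- A stable action: each point has an adapted clopen neighbourhood `U` such that for each adapted
`V ⊆ U` the restriction homomorphism from the closure of `𝓗_{U,V}` (in the uniform topology) to the
closure of `𝓗_V` has trivial kernel. -/
def IsStableAction [CompactSpace X] [T2Space X] (Φ : G →* (X ≃ₜ X)) : Prop :=
  ∀ x : X, ∃ U : Clopens X, x ∈ U ∧ IsAdapted Φ U ∧
    ∀ V : Clopens X, V ≤ U → IsAdapted Φ V →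
      ∀ h ∈ (inducedStabilizer Φ U V).topologicalClosure,
        (∀ u : U, (u : X) ∈ V → h u = u) → h = 1

/-- A wild action is one which is not stable. -/
def IsWildAction [CompactSpace X] [T2Space X] (Φ : G →* (X ≃ₜ X)) : Prop :=
  ¬ IsStableAction Φ

/-- The discriminant group of the action on `U` at `x ∈ U`: the isotropy group at `x` of the
closure of `𝓗_U` in `Homeo(U)` (the Ellis group of the action of `𝓗_U` on `U`). -/
def discriminantGroup [CompactSpace X] [T2Space X] (Φ : G →* (X ≃ₜ X)) (U : Clopens X)
    (x : X) (hx : x ∈ U) : Subgroup (U ≃ₜ U) where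
  carrier := {h | h ∈ (inducedGroup Φ U).topologicalClosure ∧ h ⟨x, hx⟩ = ⟨x, hx⟩}
  one_mem' := ⟨one_mem _, rfl⟩
  mul_mem' := by
    intro a b ha hb
    refine ⟨mul_mem ha.1 hb.1, ?_⟩
    have : (a * b) ⟨x, hx⟩ = a (b ⟨x, hx⟩) := rfl
    rw [this, hb.2, ha.2]
  inv_mem' := by
    intro a ha
    refine ⟨inv_mem ha.1, ?_⟩
    exact (a.symm_apply_eq).2 ha.2.symm

/-- `σ` is the restriction map `h ↦ h|V` between discriminant groups at `x ∈ V ⊆ U`. -/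
def IsRestrictionMap [CompactSpace X] [T2Space X] (Φ : G →* (X ≃ₜ X)) {U V : Clopens X}
    (hVU : V ≤ U) (x : X) (hx : x ∈ V)
    (σ : discriminantGroup Φ U x (hVU hx) →* discriminantGroup Φ V x hx) : Prop :=
  ∀ (h : discriminantGroup Φ U x (hVU hx)) (v : X) (hv : v ∈ V),
    ((σ h : V ≃ₜ V) ⟨v, hv⟩ : X) = (h : U ≃ₜ U) ⟨v, hVU hv⟩

/-- An adapted neighbourhood basis at `x`: a descending chain of adapted clopen sets with
intersection `{x}`. -/
structure AdaptedBasis (Φ : G →* (X ≃ₜ X)) (x : X) where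
  set : ℕ → Clopens X
  mem : ∀ j, x ∈ set j
  succ_le : ∀ j, set (j + 1) ≤ set j
  inter_eq : ⋂ j, (set j : Set X) = {x}
  adapted : ∀ j, IsAdapted Φ (set j)

end Actions

/-! ## Tail equivalence and the asymptotic discriminant -/

section Tail

universe u

/-- The composition `A m → A (m + 1) → ⋯ → A n` of the maps of a sequence, for `m ≤ n`. -/
def seqComp {A : ℕ → Type u} [∀ i, Group (A i)] (φ : ∀ i, A i →* A (i + 1)) {m n : ℕ}
    (hmn : m ≤ n) : A m →* A n :=
  Nat.leRecOn (C := fun j => A m →* A j) hmn (fun {j} f => (φ j).comp f) (MonoidHom.id (A m))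

/-- Tail equivalence of two sequences of surjective group homomorphisms: they are intertwined by a
third one, `C`, whose terms of even index are terms of the first sequence, whose terms of odd
index are terms of the second one, and whose two-step maps are the compositions of the maps
of the respective sequence. (All sequences are indexed from `0`.) -/
def TailEquivalent {A B : ℕ → Type u} [∀ i, Group (A i)] [∀ i, Group (B i)]
    (φ : ∀ i, A i →* A (i + 1)) (ψ : ∀ i, B i →* B (i + 1)) : Prop :=
  (∀ i, Function.Surjective (φ i)) ∧ (∀ i, Function.Surjective (ψ i)) ∧
  ∃ (p q : ℕ → ℕ) (hp : StrictMono p) (hq : StrictMono q)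
    (C : ℕ → Type u) (_ : ∀ i, Group (C i)) (τ : ∀ i, C i →* C (i + 1))
    (a : ∀ i, A (p i) ≃* C (2 * i)) (b : ∀ i, B (q i) ≃* C (2 * i + 1)),
    (∀ i, Function.Surjective (τ i)) ∧
    (∀ i (x : A (p i)), τ (2 * i + 1) (τ (2 * i) (a i x)) =
      a (i + 1) (seqComp φ (hp.monotone i.le_succ) x)) ∧
    (∀ i (y : B (q i)), τ (2 * i + 2) (τ (2 * i + 1) (b i y)) =
      b (i + 1) (seqComp ψ (hq.monotone i.le_succ) y))

/-- The asymptotic discriminant of the action `Φ` is the tail equivalence class of the sequence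
`ψ`: for each point `x` and each adapted neighbourhood basis at `x`, the sequence of restriction
maps between the discriminant groups at `x` (is well defined and) is tail equivalent to `ψ`. -/
def HasAsymptoticDiscriminant {G X : Type u} [Group G] [TopologicalSpace X] [CompactSpace X]
    [T2Space X] (Φ : G →* (X ≃ₜ X)) {B : ℕ → Type u} [∀ i, Group (B i)]
    (ψ : ∀ i, B i →* B (i + 1)) : Prop :=
  (∀ x : X, Nonempty (AdaptedBasis Φ x)) ∧
  ∀ (x : X) (𝒰 : AdaptedBasis Φ x),
    ∃ σ : ∀ j, discriminantGroup Φ (𝒰.set j) x (𝒰.mem j) →*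
        discriminantGroup Φ (𝒰.set (j + 1)) x (𝒰.mem (j + 1)),
      (∀ j, IsRestrictionMap Φ (𝒰.succ_le j) x (𝒰.mem (j + 1)) (σ j)) ∧ TailEquivalent σ ψ

end Tail

/-! ## The action of a finite index subgroup of `SL_N(ℤ)` -/

section Example

/-- `p_i`, the `i`-th prime in increasing order, counted from `i = 1`: `p_1 = 2`, `p_2 = 3`, …
(the value at `i = 0` is irrelevant). -/
noncomputable def nthPrime (i : ℕ) : ℕ := Nat.nth Nat.Prime (i - 1)

instance nthPrime_fact (i : ℕ) : Fact (nthPrime i).Prime :=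
  ⟨Nat.prime_nth_prime (i - 1)⟩

instance primes_fact (p : Nat.Primes) : Fact (p : ℕ).Prime := ⟨p.2⟩

/-- `SL_N(ℤ)` -/
abbrev SLZ (N : ℕ) : Type := Matrix.SpecialLinearGroup (Fin N) ℤ

/-- The finite group `SL_N(ℤ/p_iℤ)`. -/
abbrev SLmod (N i : ℕ) : Type := Matrix.SpecialLinearGroup (Fin N) (ZMod (nthPrime i))

/-- Reduction modulo `p_i`. -/
noncomputable def redMod (N i : ℕ) : SLZ N →* SLmod N i :=
  Matrix.SpecialLinearGroup.map (Int.castRingHom (ZMod (nthPrime i)))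

/-- The diagonal embedding of `SL_N(ℤ)` in `SL_N(ℤ^) = ∏_p SL_N(ℤ_p)`. -/
noncomputable def padicDiag (N : ℕ) :
    SLZ N →* (∀ p : Nat.Primes, Matrix.SpecialLinearGroup (Fin N) ℤ_[(p : ℕ)]) :=
  MonoidHom.pi fun p => Matrix.SpecialLinearGroup.map (Int.castRingHom ℤ_[(p : ℕ)])

/-- `∏_{i ≥ k} SL_N(ℤ_{p_i})` (the elements of `∏_p SL_N(ℤ_p)` whose components at all primes
smaller than `p_k` are trivial) is contained in the closure of `G` in
`SL_N(ℤ^) = ∏_p SL_N(ℤ_p)`. -/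
def ContainsLargePrimes {N : ℕ} (G : Subgroup (SLZ N)) (k : ℕ) : Prop :=
  ∀ x : ∀ p : Nat.Primes, Matrix.SpecialLinearGroup (Fin N) ℤ_[(p : ℕ)],
    (∀ p : Nat.Primes, (p : ℕ) < nthPrime k → x p = 1) → x ∈ closure (padicDiag N '' (G : Set (SLZ N)))

variable {N : ℕ}

/-- The space `X = ∏_{i ≥ k} SL_N(ℤ/p_iℤ) / A_i`, with the product of the discrete topologies. -/
abbrev ProductSpace (k : ℕ) (A : ∀ i, Subgroup (SLmod N i)) : Type :=
  ∀ i : {i : ℕ // k ≤ i}, SLmod N i ⧸ A i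

instance slmod_discrete (i : ℕ) : DiscreteTopology (SLmod N i) := inferInstance
instance slmod_finite (i : ℕ) : Finite (SLmod N i) := inferInstance
instance slmod_quot_discrete (i : ℕ) (B : Subgroup (SLmod N i)) :
    DiscreteTopology (SLmod N i ⧸ B) := inferInstance

/-- The action `Φ_0` of `SL_N(ℤ)` on `X`: in the `i`-th coordinate, left multiplication by the
reduction modulo `p_i`. -/
noncomputable def productAction (k : ℕ) (A : ∀ i, Subgroup (SLmod N i)) :
    SLZ N →* (ProductSpace k A ≃ₜ ProductSpace k A) where
  toFun g :=
    { toFun := fun x i => redMod N i g • x i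
      invFun := fun x i => (redMod N i g)⁻¹ • x i
      left_inv := fun x => by funext i; exact inv_smul_smul _ _
      right_inv := fun x => by funext i; exact smul_inv_smul _ _
      continuous_toFun := continuous_pi fun i =>
        continuous_of_discreteTopology.comp (continuous_apply i)
      continuous_invFun := continuous_pi fun i =>
        continuous_of_discreteTopology.comp (continuous_apply i) }
  map_one' := by
    ext x i
    change redMod N i 1 • x i = x i
    rw [map_one, one_smul]
  map_mul' g g' := by
    ext x i
    change redMod N i (g * g') • x i = redMod N i g • redMod N i g' • x i
    rw [map_mul, mul_smul]

/-- The base point `x_0 = (e A_i)_i` of `X`. -/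
noncomputable def basePoint (k : ℕ) (A : ∀ i, Subgroup (SLmod N i)) : ProductSpace k A :=
  fun i => ((1 : SLmod N i) : SLmod N i ⧸ A i)

/-- The clopen neighbourhood `U_n = ∏_{k ≤ i < n} {e A_i} × ∏_{i ≥ n} SL_N(ℤ/p_iℤ) / A_i` of the
base point. -/
noncomputable def cylinder (k : ℕ) (A : ∀ i, Subgroup (SLmod N i)) (n : ℕ) : Clopens (ProductSpace k A) where
  carrier := {x | ∀ i : {i : ℕ // k ≤ i}, (i : ℕ) < n → x i = basePoint k A i}
  isClopen' := by
    have hfin : {i : {i : ℕ // k ≤ i} | (i : ℕ) < n}.Finite :=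
      (Set.finite_lt_nat n).preimage Subtype.val_injective.injOn
    have h : {x : ProductSpace k A | ∀ i : {i : ℕ // k ≤ i}, (i : ℕ) < n → x i = basePoint k A i} =
        ⋂ i ∈ {i : {i : ℕ // k ≤ i} | (i : ℕ) < n}, (fun x => x i) ⁻¹' {basePoint k A i} := by
      ext x; simp
    rw [h]
    exact hfin.isClopen_biInter fun i _ => (isClopen_discrete _).preimage (continuous_apply i)

theorem basePoint_mem_cylinder (k : ℕ) (A : ∀ i, Subgroup (SLmod N i)) (n : ℕ) :
    basePoint k A ∈ cylinder k A n := fun _ _ => rfl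

theorem cylinder_succ_le (k : ℕ) (A : ∀ i, Subgroup (SLmod N i)) (n : ℕ) :
    cylinder k A (n + 1) ≤ cylinder k A n :=
  fun _ hx i hi => hx i (Nat.lt_succ_of_lt hi)

/-- The group `𝓓_n = ∏_{i ≥ n} A_i`. -/
abbrev DiscProduct (A : ∀ i, Subgroup (SLmod N i)) (n : ℕ) : Type :=
  ∀ i : {i : ℕ // n ≤ i}, A i

/-- The projection `ψ_n : ∏_{i ≥ n} A_i → ∏_{i ≥ n + 1} A_i`. -/
def discProj (A : ∀ i, Subgroup (SLmod N i)) (n : ℕ) : DiscProduct A n →* DiscProduct A (n + 1) where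
  toFun d i := d ⟨i, n.le_succ.trans i.2⟩
  map_one' := rfl
  map_mul' _ _ := rfl

end Example

/-! Since `SL_N(ℤ_p) → SL_N(ℤ/p)` is surjective, the hypothesis on the closure of `G` makes `G`
dense in the compact group `Γ = ∏_{i ≥ k} SL_N(ℤ/p_iℤ)`, which acts continuously and transitively on
`X`. Minimality and equicontinuity follow, and the closure of `𝓗_U` is the image in `Homeo(U)` of
the open subgroup of `Γ` preserving `U` (`closure_inducedGroup`). The adapted sets are exactly the
non-empty clopen blocks of `Γ`. The hard direction (`IsAdapted.isBlockSet`) uses that the action of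
`G` is topologically free: by the trivial cores, an element fixing an open set pointwise is `1`
modulo all large primes, hence is `1`. So every discriminant group at `x` is a quotient of the
isotropy group `Γ_x`, by the elements acting trivially on `U`. For a cylinder of level `n` these are
the elements with trivial coordinates from `n` on, which leaves `∏_{i ≥ n} A_i`. An element of `A_i`
alone in coordinate `i` moves points of small cylinders but is the identity on smaller ones, so the
action is wild. For an arbitrary adapted basis the kernels in `Γ_x` interleave with those of the
cylinders, and this gives tail equivalence (`tailEquivalent_of_ker`). -/

/-! ## Actions factoring through a compact group -/

section CompactGroup

variable {G Γ X : Type*} [Group G] [Group Γ] [TopologicalSpace X] [MulAction Γ X]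

/-- The subgroup of those elements of `Γ` that map `U` onto itself. -/
def setStab (Γ : Type*) [Group Γ] [MulAction Γ X] (U : Clopens X) : Subgroup Γ where
  carrier := {γ | ∀ x : X, γ • x ∈ U ↔ x ∈ U}
  one_mem' := fun x => by rw [one_smul]
  mul_mem' := fun {a b} ha hb x => by rw [mul_smul]; exact (ha _).trans (hb x)
  inv_mem' := fun {a} ha x => by
    have := ha (a⁻¹ • x)
    rw [smul_inv_smul] at this
    exact this.symm

/-- `U` is a block of the action of `Γ`: a translate of `U` that meets `U` is equal to `U`. -/
def IsBlockSet (Γ : Type*) [Group Γ] [MulAction Γ X] (U : Clopens X) : Prop :=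
  ∀ (γ : Γ) (x : X), x ∈ U → γ • x ∈ U → γ ∈ setStab Γ U

theorem IsBlockSet.stabilizer_le {U : Clopens X} (hU : IsBlockSet Γ U) {x : X} (hx : x ∈ U) :
    MulAction.stabilizer Γ x ≤ setStab Γ U := fun γ hγ =>
  hU γ x hx (by rw [MulAction.mem_stabilizer_iff.1 hγ]; exact hx)

variable [TopologicalSpace Γ] [ContinuousSMul Γ X]

/-- The action of the stabilizer of `U` on `U`. -/
def restrictHom (U : Clopens X) : setStab Γ U →* (U ≃ₜ U) where
  toFun γ := (Homeomorph.smul (γ : Γ)).subtype fun x => (γ.2 x).symm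
  map_one' := by ext u; exact one_smul Γ (u : X)
  map_mul' a b := by ext u; exact mul_smul (a : Γ) (b : Γ) (u : X)

@[simp] theorem restrictHom_apply (U : Clopens X) (γ : setStab Γ U) (u : U) :
    ((restrictHom U γ u : U) : X) = (γ : Γ) • (u : X) := rfl

theorem restrictHom_eq_one_iff {U : Clopens X} {γ : setStab Γ U} :
    restrictHom U γ = 1 ↔ ∀ x ∈ U, (γ : Γ) • x = x := by
  constructor
  · intro h x hx
    have := congrArg Subtype.val (DFunLike.congr_fun h ⟨x, hx⟩)
    exact this
  · intro h
    ext u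
    exact h u u.2

theorem continuous_restrictHom (U : Clopens X) : Continuous (restrictHom (Γ := Γ) U) := by
  refine continuous_induced_rng.2 (ContinuousMap.continuous_of_continuous_uncurry _ ?_)
  refine Continuous.subtype_mk (f := fun p : setStab Γ U × U => (p.1 : Γ) • (p.2 : X)) ?_ _
  exact (continuous_subtype_val.comp continuous_fst).smul
    (continuous_subtype_val.comp continuous_snd)

/-- Mapping the compact set `U` into the open set `U` is an open condition in the compact-open
topology; it is imposed on both `γ` and `γ⁻¹`. -/
theorem isOpen_setStab [IsTopologicalGroup Γ] [CompactSpace X] (U : Clopens X) :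
    IsOpen (setStab Γ U : Set Γ) := by
  have hc : Continuous fun γ : Γ => (⟨fun x => γ • x, continuous_const_smul γ⟩ : C(X, X)) :=
    ContinuousMap.continuous_of_continuous_uncurry _ continuous_smul
  have h1 : IsOpen {γ : Γ | ∀ x ∈ U, γ • x ∈ U} :=
    (ContinuousMap.isOpen_setOfPred_mapsTo U.isClopen.isClosed.isCompact
      U.isClopen.isOpen).preimage hc
  have h2 : IsOpen {γ : Γ | ∀ x ∈ U, γ⁻¹ • x ∈ U} := h1.preimage continuous_inv
  convert h1.inter h2 using 1
  ext γ
  constructor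
  · intro h
    exact ⟨fun x hx => (h x).2 hx, fun x hx => ((setStab Γ U).inv_mem h x).2 hx⟩
  · rintro ⟨h, h'⟩ x
    refine ⟨fun hx => ?_, h x⟩
    have := h' _ hx
    rwa [inv_smul_smul] at this

instance homeoT2Space {Y : Type*} [TopologicalSpace Y] [T2Space Y] : T2Space (Y ≃ₜ Y) :=
  T2Space.of_injective_continuous (f := fun h : Y ≃ₜ Y => (h : C(Y, Y)))
    (fun a b h => by ext y; exact DFunLike.congr_fun h y) continuous_homeo_coe

/-- Compactness of `Γ` provides one neighbourhood of `x` that serves all `γ`; compactness of `X`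
then makes equicontinuity uniform. -/
theorem equicontinuous_of_compact [CompactSpace X] [T2Space X] [CompactSpace Γ]
    {Φ : G →* (X ≃ₜ X)} {ρ : G →* Γ} (hΦ : ∀ g x, Φ g x = ρ g • x) :
    IsEquicontinuousAction Φ := by
  let _ : UniformSpace X := uniformSpaceOfCompactR1
  change UniformEquicontinuous fun (g : G) (x : X) => Φ g x
  apply CompactSpace.uniformEquicontinuous_of_equicontinuous
  intro x V hV
  have key : ∀ᶠ y in 𝓝 x, ∀ γ ∈ (Set.univ : Set Γ), (γ • x, γ • y) ∈ V := by
    apply isCompact_univ.eventually_forall_of_forall_eventually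
    intro γ _
    have hc : Continuous fun z : X × Γ => (z.2 • x, z.2 • z.1) := by fun_prop
    have := hc.tendsto (x, γ)
    exact this.eventually (nhds_le_uniformity (γ • x) hV)
  filter_upwards [key] with y hy g
  rw [hΦ, hΦ]
  exact hy _ trivial

/-- A homeomorphism of `U` given by `γ` in an open set `O` is a limit of those given by the elements
of the image of `G` in `O`. -/
theorem restrictHom_mem_closure [IsTopologicalGroup Γ] [CompactSpace X] {ρ : G →* Γ} (hρ : DenseRange ρ)
    {U : Clopens X} {S : Set (U ≃ₜ U)} {O : Set Γ} (hO : IsOpen O)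
    (hS : ∀ g (hg : ρ g ∈ setStab Γ U), ρ g ∈ O → restrictHom U ⟨ρ g, hg⟩ ∈ S)
    (γ : setStab Γ U) (hγ : (γ : Γ) ∈ O) : restrictHom U γ ∈ closure S := by
  rw [mem_closure_iff]
  intro W hW hγW
  have h1 : IsOpen ((restrictHom (Γ := Γ) U) ⁻¹' W) := hW.preimage (continuous_restrictHom U)
  -- The stabilizer is open, so this set is open in `Γ` itself, where the image of `G` is dense.
  have h2 : IsOpen ((Subtype.val : setStab Γ U → Γ) '' ((restrictHom (Γ := Γ) U) ⁻¹' W)) :=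
    (isOpen_setStab U).isOpenMap_subtype_val _ h1
  obtain ⟨g, ⟨⟨δ, hδ⟩, hδW, hδg⟩, hgO⟩ := hρ.exists_mem_open (h2.inter hO) ⟨γ, ⟨γ, hγW, rfl⟩, hγ⟩
  simp only at hδg
  subst hδg
  exact ⟨_, hδW, hS g hδ hgO⟩

/-- An open subgroup is closed, hence compact here, so its image in the Hausdorff group `Homeo(U)`
is already closed; density of `G` gives the other inclusion. -/
theorem closure_inducedGroup [IsTopologicalGroup Γ] [CompactSpace Γ] [CompactSpace X] [T2Space X]
    {Φ : G →* (X ≃ₜ X)} {ρ : G →* Γ} (hΦ : ∀ g x, Φ g x = ρ g • x) (hρ : DenseRange ρ)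
    (U : Clopens X) :
    (inducedGroup Φ U).topologicalClosure = (restrictHom (Γ := Γ) U).range := by
  apply le_antisymm
  · apply Subgroup.topologicalClosure_minimal
    · rintro h ⟨g, hg⟩
      -- Surjectivity of `h` on `U` shows that no point outside `U` is sent into `U`.
      have hgU : ρ g ∈ setStab Γ U := fun x => by
        constructor
        · intro hx
          obtain ⟨v, hv⟩ := h.surjective ⟨_, hx⟩
          have h1 := hg v
          rw [hv, hΦ] at h1
          have := MulAction.injective (ρ g) h1
          rw [this]
          exact v.2
        · intro hx
          rw [← hΦ, ← hg ⟨x, hx⟩]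
          exact (h ⟨x, hx⟩).2
      refine ⟨⟨ρ g, hgU⟩, ?_⟩
      ext u
      rw [restrictHom_apply, hg, hΦ]
    · have : IsClosed (setStab Γ U : Set Γ) := (setStab Γ U).isClosed_of_isOpen (isOpen_setStab U)
      have : CompactSpace (setStab Γ U) := isCompact_iff_compactSpace.1 this.isCompact
      rw [MonoidHom.coe_range]
      exact (isCompact_range (continuous_restrictHom U)).isClosed
  · rintro _ ⟨γ, rfl⟩
    refine restrictHom_mem_closure hρ isOpen_univ (fun g hg _ => ?_) γ trivial
    exact ⟨g, fun u => (hΦ g u).symm⟩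

theorem IsBlockSet.isAdapted {Φ : G →* (X ≃ₜ X)} {ρ : G →* Γ} (hΦ : ∀ g x, Φ g x = ρ g • x)
    {U : Clopens X} (hne : (U : Set X).Nonempty) (hU : IsBlockSet Γ U) : IsAdapted Φ U := by
  refine ⟨hne, fun g W _ hWU hgW => ?_⟩
  rcases W.eq_empty_or_nonempty with rfl | ⟨w, hw⟩
  · exact ⟨1, one_mem _, fun w hw => hw.elim⟩
  · have hg : ρ g ∈ setStab Γ U := hU _ w (hWU hw) (by rw [← hΦ]; exact hgW w hw)
    exact ⟨restrictHom U ⟨ρ g, hg⟩, ⟨g, fun u => (hΦ g u).symm⟩, fun w hw => (hΦ g w).symm⟩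

/-- Approximate `γ` by some `g` in `G` that agrees with it modulo the open stabilizer of `U`.
Adaptedness replaces `g`, on the open set where it stays in `U`, by a `g'` preserving `U`;
topological freeness (`hfree`) forces `ρ g = ρ g'`, so `ρ g`, and with it `γ`, preserves `U`. -/
theorem IsAdapted.isBlockSet [IsTopologicalGroup Γ] [CompactSpace X] {Φ : G →* (X ≃ₜ X)}
    {ρ : G →* Γ} (hΦ : ∀ g x, Φ g x = ρ g • x) (hρ : DenseRange ρ)
    (hfree : ∀ (g : G) (W : Set X), IsOpen W → W.Nonempty → (∀ w ∈ W, ρ g • w = w) → ρ g = 1)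
    {U : Clopens X} (hU : IsAdapted Φ U) : IsBlockSet Γ U := by
  intro γ u hu hγu
  have hO : IsOpen ({δ : Γ | δ • u ∈ U} ∩ {δ : Γ | γ⁻¹ * δ ∈ setStab Γ U}) :=
    (U.isClopen.isOpen.preimage (by fun_prop : Continuous fun δ : Γ => δ • u)).inter
      ((isOpen_setStab U).preimage (continuous_const_mul γ⁻¹))
  obtain ⟨g, hgu, hgγ⟩ := hρ.exists_mem_open hO ⟨γ, hγu, by
    change γ⁻¹ * γ ∈ setStab Γ U
    rw [inv_mul_cancel]
    exact one_mem _⟩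
  have hW : IsOpen {x : X | x ∈ U ∧ ρ g • x ∈ U} :=
    U.isClopen.isOpen.inter (U.isClopen.isOpen.preimage (continuous_const_smul (ρ g)))
  obtain ⟨h, ⟨g', hg'⟩, hh⟩ := hU.2 g {x : X | x ∈ U ∧ ρ g • x ∈ U} hW (fun x hx => hx.1)
    (fun x hx => by rw [hΦ]; exact hx.2)
  have hgg : ρ (g'⁻¹ * g) = 1 := by
    refine hfree _ _ hW ⟨u, hu, hgu⟩ fun w hw => ?_
    have h1 := hh w hw
    rw [hg', hΦ, hΦ] at h1
    rw [map_mul, map_inv, mul_smul, ← h1]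
    exact inv_smul_smul _ _
  have hρg : ρ g = ρ g' := by
    rw [map_mul, map_inv, inv_mul_eq_one] at hgg
    exact hgg.symm
  have hg'U : ∀ x, x ∈ U → ρ g' • x ∈ U := fun x hx => by
    rw [← hΦ, ← hg' ⟨x, hx⟩]
    exact (h ⟨x, hx⟩).2
  have hgU : ρ g ∈ setStab Γ U := by
    intro x
    rw [hρg]
    refine ⟨fun hx => ?_, hg'U x⟩
    obtain ⟨v, hv⟩ := h.surjective ⟨_, hx⟩
    have h1 := hg' v
    rw [hv, hΦ] at h1
    rw [MulAction.injective (ρ g') h1]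
    exact v.2
  have := (setStab Γ U).mul_mem hgU ((setStab Γ U).inv_mem hgγ)
  simpa using this

/-- The isotropy group of `x` in `Γ` maps to the discriminant group at `x`. -/
def isotropyHom [IsTopologicalGroup Γ] [CompactSpace Γ] [CompactSpace X] [T2Space X]
    {Φ : G →* (X ≃ₜ X)} {ρ : G →* Γ} (hΦ : ∀ g x, Φ g x = ρ g • x) (hρ : DenseRange ρ)
    {U : Clopens X} (hU : IsBlockSet Γ U) {x : X} (hx : x ∈ U) :
    MulAction.stabilizer Γ x →* discriminantGroup Φ U x hx :=
  ((restrictHom U).comp (Subgroup.inclusion (hU.stabilizer_le hx))).codRestrict _ fun γ => by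
    refine ⟨?_, Subtype.ext γ.2⟩
    rw [closure_inducedGroup hΦ hρ]
    exact ⟨_, rfl⟩

section

variable [IsTopologicalGroup Γ] [CompactSpace Γ] [CompactSpace X] [T2Space X]
  {Φ : G →* (X ≃ₜ X)} {ρ : G →* Γ} (hΦ : ∀ g x, Φ g x = ρ g • x) (hρ : DenseRange ρ)

theorem continuous_isotropyHom {U : Clopens X} (hU : IsBlockSet Γ U) {x : X} (hx : x ∈ U) :
    Continuous (isotropyHom hΦ hρ hU hx) :=
  ((continuous_restrictHom U).comp
    (continuous_inclusion (hU.stabilizer_le hx))).subtype_mk _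

/-- This presents the discriminant groups of all blocks around `x` as quotients of one group, so
that they can be compared through kernels. -/
theorem isotropyHom_surjective {U : Clopens X} (hU : IsBlockSet Γ U) {x : X} (hx : x ∈ U) :
    Function.Surjective (isotropyHom hΦ hρ hU hx) := by
  rintro ⟨h, hcl, hfix⟩
  rw [closure_inducedGroup hΦ hρ] at hcl
  obtain ⟨γ, rfl⟩ := hcl
  exact ⟨⟨γ, congrArg Subtype.val hfix⟩, rfl⟩

theorem isotropyHom_eq_iff {U : Clopens X} (hU : IsBlockSet Γ U) {x : X} (hx : x ∈ U)
    {γ δ : MulAction.stabilizer Γ x} :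
    isotropyHom hΦ hρ hU hx γ = isotropyHom hΦ hρ hU hx δ ↔
      ∀ u ∈ U, (γ : Γ) • u = (δ : Γ) • u := by
  constructor
  · intro h u hu
    exact congrArg Subtype.val (DFunLike.congr_fun (congrArg Subtype.val h) ⟨u, hu⟩)
  · intro h
    apply Subtype.ext
    ext u
    exact h u u.2

theorem mem_ker_isotropyHom {U : Clopens X} (hU : IsBlockSet Γ U) {x : X} (hx : x ∈ U)
    {γ : MulAction.stabilizer Γ x} :
    γ ∈ (isotropyHom hΦ hρ hU hx).ker ↔ ∀ u ∈ U, (γ : Γ) • u = u := by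
  rw [MonoidHom.mem_ker, ← map_one (isotropyHom hΦ hρ hU hx), isotropyHom_eq_iff]
  simp only [OneMemClass.coe_one, one_smul]

/-- What acts trivially on `U` acts trivially on `V`, so one quotient map of the isotropy group
factors through the other. -/
theorem exists_restrictionMap {U V : Clopens X} (hU : IsBlockSet Γ U) (hV : IsBlockSet Γ V)
    (hVU : V ≤ U) {x : X} (hx : x ∈ V) :
    ∃ σ : discriminantGroup Φ U x (hVU hx) →* discriminantGroup Φ V x hx,
      IsRestrictionMap Φ hVU x hx σ ∧
      ∀ γ, σ (isotropyHom hΦ hρ hU (hVU hx) γ) = isotropyHom hΦ hρ hV hx γ := by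
  have hs := isotropyHom_surjective hΦ hρ hU (hVU hx)
  have hker : (isotropyHom hΦ hρ hU (hVU hx)).ker ≤ (isotropyHom hΦ hρ hV hx).ker := by
    intro γ hγ
    rw [mem_ker_isotropyHom] at hγ ⊢
    exact fun u hu => hγ u (hVU hu)
  have key : ∀ γ, MonoidHom.liftOfSurjective _ hs ⟨isotropyHom hΦ hρ hV hx, hker⟩
      (isotropyHom hΦ hρ hU (hVU hx) γ) = isotropyHom hΦ hρ hV hx γ :=
    MonoidHom.liftOfRightInverse_comp_apply _ _ _ _
  refine ⟨_, ?_, key⟩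
  intro h v hv
  obtain ⟨γ, rfl⟩ := hs h
  rw [key]
  rfl

end

end CompactGroup

/-! ## Tail equivalence of quotient sequences -/

section Tail

universe u

theorem seqComp_apply {P : Type*} [Group P] {A : ℕ → Type u} [∀ i, Group (A i)]
    {φ : ∀ i, A i →* A (i + 1)} {α : ∀ i, P →* A i} (h : ∀ i x, φ i (α i x) = α (i + 1) x)
    {m n : ℕ} (hmn : m ≤ n) (x : P) : seqComp φ hmn (α m x) = α n x := by
  induction n, hmn using Nat.le_induction with
  | base => simp [seqComp, Nat.leRecOn_self]
  | succ n hmn ih =>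
    unfold seqComp at ih ⊢
    rw [Nat.leRecOn_succ hmn, MonoidHom.comp_apply, ih, h]

theorem ker_le_ker_of_le {P : Type*} [Group P] {A : ℕ → Type u} [∀ i, Group (A i)]
    {φ : ∀ i, A i →* A (i + 1)} {α : ∀ i, P →* A i} (h : ∀ i x, φ i (α i x) = α (i + 1) x)
    {m n : ℕ} (hmn : m ≤ n) : (α m).ker ≤ (α n).ker := by
  intro x hx
  rw [MonoidHom.mem_ker] at hx ⊢
  rw [← seqComp_apply h hmn, hx, map_one]

theorem exists_interleaving {r s : ℕ → ℕ → Prop} (hr : ∀ j, ∃ m, ∀ m', m ≤ m' → r j m')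
    (hs : ∀ m, ∃ j, ∀ j', j ≤ j' → s m j') :
    ∃ p q : ℕ → ℕ, StrictMono p ∧ StrictMono q ∧ (∀ i, r (p i) (q i)) ∧
      ∀ i, s (q i) (p (i + 1)) := by
  choose f hf using hr
  choose g hg using hs
  -- Each new index exceeds both the threshold set by the other sequence and its own predecessor;
  -- the start `f 0` secures `r` at index `0`.
  let F : ℕ × ℕ → ℕ × ℕ := fun z =>
    let a := max (g z.2) (z.1 + 1)
    (a, max (f a) (z.2 + 1))
  let z : ℕ → ℕ × ℕ := fun i => F^[i] (0, f 0)
  have hz : ∀ i, z (i + 1) = F (z i) := fun i => Function.iterate_succ_apply' F i _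
  refine ⟨fun i => (z i).1, fun i => (z i).2, strictMono_nat_of_lt_succ fun i => ?_,
    strictMono_nat_of_lt_succ fun i => ?_, fun i => ?_, fun i => ?_⟩
  · rw [hz]; exact lt_of_lt_of_le (Nat.lt_succ_self _) (le_max_right _ _)
  · rw [hz]; exact lt_of_lt_of_le (Nat.lt_succ_self _) (le_max_right _ _)
  · cases i with
    | zero => exact hf _ _ le_rfl
    | succ i => dsimp only; rw [hz]; exact hf _ _ (le_max_left _ _)
  · dsimp only; rw [hz]; exact hg _ _ (le_max_left _ _)

/-- Two sequences of quotients of one group are tail equivalent if their kernels interleave. -/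
theorem tailEquivalent_of_ker {P : Type u} [Group P] {A B : ℕ → Type u} [∀ i, Group (A i)]
    [∀ i, Group (B i)] {φ : ∀ i, A i →* A (i + 1)} {ψ : ∀ i, B i →* B (i + 1)}
    {α : ∀ i, P →* A i} {β : ∀ i, P →* B i}
    (hα : ∀ i, Function.Surjective (α i)) (hβ : ∀ i, Function.Surjective (β i))
    (hφ : ∀ i x, φ i (α i x) = α (i + 1) x) (hψ : ∀ i x, ψ i (β i x) = β (i + 1) x)
    (hαβ : ∀ j, ∃ m, (α j).ker ≤ (β m).ker) (hβα : ∀ m, ∃ j, (β m).ker ≤ (α j).ker) :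
    TailEquivalent φ ψ := by
  refine ⟨fun i y => ?_, fun i y => ?_, ?_⟩
  · obtain ⟨x, rfl⟩ := hα (i + 1) y
    exact ⟨_, hφ i x⟩
  · obtain ⟨x, rfl⟩ := hβ (i + 1) y
    exact ⟨_, hψ i x⟩
  obtain ⟨p, q, hp, hq, hr, hs⟩ := exists_interleaving
    (r := fun j m => (α j).ker ≤ (β m).ker) (s := fun m j => (β m).ker ≤ (α j).ker)
    (fun j => (hαβ j).imp fun m hm m' h => hm.trans (ker_le_ker_of_le hψ h))
    (fun m => (hβα m).imp fun j hj j' h => hj.trans (ker_le_ker_of_le hφ h))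
  -- The intertwining sequence is `P ⧸ K j`, with the two families of kernels taken alternately.
  let K : ℕ → Subgroup P := fun j => if Even j then (α (p (j / 2))).ker else (β (q (j / 2))).ker
  have hKn : ∀ j, (K j).Normal := fun j => by
    dsimp only [K]
    split_ifs <;> infer_instance
  have hKe : ∀ i, (α (p i)).ker = K (2 * i) := fun i => by
    dsimp only [K]
    rw [if_pos (even_two_mul i), Nat.mul_div_cancel_left i two_pos]
  have hKo : ∀ i, (β (q i)).ker = K (2 * i + 1) := fun i => by
    dsimp only [K]
    rw [if_neg (by simp), show (2 * i + 1) / 2 = i by omega]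
  have hK : ∀ j, K j ≤ K (j + 1) := fun j => by
    obtain ⟨i, rfl | rfl⟩ := Nat.even_or_odd' j
    · rw [← hKe, ← hKo]; exact hr i
    · rw [← hKo, show 2 * i + 1 + 1 = 2 * (i + 1) by ring, ← hKe]; exact hs i
  let a : ∀ i, A (p i) ≃* P ⧸ K (2 * i) := fun i =>
    (QuotientGroup.quotientKerEquivOfSurjective _ (hα (p i))).symm.trans
      (QuotientGroup.quotientMulEquivOfEq (hKe i))
  let b : ∀ i, B (q i) ≃* P ⧸ K (2 * i + 1) := fun i =>
    (QuotientGroup.quotientKerEquivOfSurjective _ (hβ (q i))).symm.trans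
      (QuotientGroup.quotientMulEquivOfEq (hKo i))
  have ha : ∀ i x, a i (α (p i) x) = (x : P ⧸ K (2 * i)) := fun i x => by
    have : α (p i) x = QuotientGroup.quotientKerEquivOfSurjective _ (hα (p i)) (x : P ⧸ _) := rfl
    dsimp only [a]
    rw [MulEquiv.trans_apply, this, MulEquiv.symm_apply_apply]
    rfl
  have hb : ∀ i x, b i (β (q i) x) = (x : P ⧸ K (2 * i + 1)) := fun i x => by
    have : β (q i) x = QuotientGroup.quotientKerEquivOfSurjective _ (hβ (q i)) (x : P ⧸ _) := rfl
    dsimp only [b]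
    rw [MulEquiv.trans_apply, this, MulEquiv.symm_apply_apply]
    rfl
  refine ⟨p, q, hp, hq, fun j => P ⧸ K j, fun j => inferInstance,
    fun j => QuotientGroup.map (K j) (K (j + 1)) (MonoidHom.id P) (hK j), a, b, ?_, ?_, ?_⟩
  · intro j y
    obtain ⟨x, rfl⟩ := QuotientGroup.mk_surjective y
    exact ⟨(x : P ⧸ K j), rfl⟩
  · intro i y
    obtain ⟨x, rfl⟩ := hα _ y
    rw [seqComp_apply hφ, ha, ha]
    rfl
  · intro i y
    obtain ⟨x, rfl⟩ := hβ _ y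
    rw [seqComp_apply hψ, hb, hb]
    rfl

end Tail

/-! ## Density of the reductions -/

section Reduction

/-- Positivity is needed because truncated subtraction gives `nthPrime 0 = nthPrime 1`. -/
theorem nthPrime_injOn {i j : ℕ} (hi : 1 ≤ i) (hj : 1 ≤ j) (h : nthPrime i = nthPrime j) :
    i = j := by
  have := Nat.nth_injective Nat.infinite_setOfPred_prime h
  omega

theorem nthPrime_mono {i j : ℕ} (h : i ≤ j) : nthPrime i ≤ nthPrime j :=
  (Nat.nth_strictMono Nat.infinite_setOfPred_prime).monotone (Nat.sub_le_sub_right h 1)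

theorem le_nthPrime (i : ℕ) : i - 1 ≤ nthPrime i :=
  (Nat.nth_strictMono Nat.infinite_setOfPred_prime).le_apply

/-- The kernel is the maximal ideal, which is the open unit ball, so the map is constant near `0`.
-/
theorem PadicInt.continuous_toZMod (p : ℕ) [Fact p.Prime] :
    Continuous (PadicInt.toZMod : ℤ_[p] →+* ZMod p) := by
  apply continuous_of_continuousAt_zero
  rw [ContinuousAt, map_zero]
  apply Filter.Tendsto.congr' (f₁ := fun _ => (0 : ZMod p)) _ tendsto_const_nhds
  filter_upwards [Metric.ball_mem_nhds (0 : ℤ_[p]) one_pos] with x hx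
  symm
  rw [← RingHom.mem_ker, PadicInt.ker_toZMod, IsLocalRing.mem_maximalIdeal,
    PadicInt.mem_nonunits]
  simpa using hx

/-- Matrices of determinant one lift along a surjection with local source. -/
theorem Matrix.SpecialLinearGroup.map_surjective_of_isLocalHom {n R S : Type*} [Fintype n]
    [DecidableEq n] [Nonempty n] [CommRing R] [CommRing S] {f : R →+* S} [IsLocalHom f]
    (hf : Function.Surjective f) :
    Function.Surjective (Matrix.SpecialLinearGroup.map (n := n) f) := by
  intro y
  choose s hs using hf
  let M : Matrix n n R := y.1.map s
  have hM : f.mapMatrix M = y.1 := by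
    ext i j
    exact hs _
  have hdet : f M.det = 1 := by
    rw [RingHom.map_det, hM]
    exact y.2
  obtain ⟨u, hu⟩ : IsUnit M.det := isUnit_of_map_unit f _ (by rw [hdet]; exact isUnit_one)
  have hfu : f (↑u⁻¹ : R) = 1 := by
    have h1 : f (↑u⁻¹ * ↑u : R) = 1 := by rw [Units.inv_mul, map_one]
    rwa [map_mul, hu, hdet, mul_one] at h1
  obtain ⟨j⟩ := ‹Nonempty n›
  -- An entrywise lift has a unit determinant that reduces to `1`; dividing one row by it corrects
  -- the determinant without changing the reduction.
  refine ⟨⟨M.updateRow j ((↑u⁻¹ : R) • M j), ?_⟩, ?_⟩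
  · rw [Matrix.det_updateRow_smul, Matrix.updateRow_eq_self, ← hu, Units.inv_mul]
  · ext a b
    change f (M.updateRow j ((↑u⁻¹ : R) • M j) a b) = y.1 a b
    rw [Matrix.updateRow_apply]
    split_ifs with h
    · subst h
      rw [Pi.smul_apply, smul_eq_mul, map_mul, hfu, one_mul]
      exact hs _
    · exact hs _

instance PadicInt.isLocalHom_toZMod (p : ℕ) [Fact p.Prime] :
    IsLocalHom (PadicInt.toZMod : ℤ_[p] →+* ZMod p) where
  map_nonunit a ha := by
    by_contra h
    have h1 : a ∈ RingHom.ker (PadicInt.toZMod : ℤ_[p] →+* ZMod p) := by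
      rw [PadicInt.ker_toZMod]
      exact h
    rw [RingHom.mem_ker] at h1
    rw [h1] at ha
    exact not_isUnit_zero ha

/-- `∏_{i ≥ k} SL_N(ℤ/p_iℤ)`. -/
abbrev ModProduct (N k : ℕ) : Type := ∀ i : {i : ℕ // k ≤ i}, SLmod N i

/-- The reductions modulo all `p_i` with `i ≥ k`. -/
noncomputable def redProd (N k : ℕ) : SLZ N →* ModProduct N k :=
  MonoidHom.pi fun i => redMod N i

/-- The reduction of `∏_p SL_N(ℤ_p)`. -/
noncomputable def padicRed (N k : ℕ)
    (x : ∀ p : Nat.Primes, Matrix.SpecialLinearGroup (Fin N) ℤ_[(p : ℕ)]) : ModProduct N k :=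
  fun i => Matrix.SpecialLinearGroup.map (PadicInt.toZMod : ℤ_[nthPrime i] →+* _)
    (x ⟨nthPrime i, (nthPrime_fact i).out⟩)

theorem continuous_padicRed (N k : ℕ) : Continuous (padicRed N k) :=
  continuous_pi fun i =>
    (PadicInt.continuous_toZMod _).specialLinearGroup_map.comp
      (continuous_apply (A := fun p : Nat.Primes => Matrix.SpecialLinearGroup (Fin N) ℤ_[(p : ℕ)])
        ⟨nthPrime i, (nthPrime_fact i).out⟩)

theorem padicRed_padicDiag (N k : ℕ) (g : SLZ N) : padicRed N k (padicDiag N g) = redProd N k g := by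
  funext i
  ext a b
  change PadicInt.toZMod (Int.castRingHom ℤ_[nthPrime i] (g.1 a b)) =
    Int.castRingHom (ZMod (nthPrime i)) (g.1 a b)
  simp

theorem exists_padicRed_eq {N k : ℕ} [NeZero N] (hk : 1 ≤ k) (y : ModProduct N k) :
    ∃ x : ∀ p : Nat.Primes, Matrix.SpecialLinearGroup (Fin N) ℤ_[(p : ℕ)],
      (∀ p : Nat.Primes, (p : ℕ) < nthPrime k → x p = 1) ∧ padicRed N k x = y := by
  -- Components at the primes `p_i` with `i ≥ k` are lifts of `y i`, all others are `1`. Quantifying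
  -- over families with `x p = z` avoids transporting matrices between the types attached to equal
  -- primes.
  have key : ∀ p : Nat.Primes, ∃ z : Matrix.SpecialLinearGroup (Fin N) ℤ_[(p : ℕ)],
      ((p : ℕ) < nthPrime k → z = 1) ∧
        ∀ x : ∀ p : Nat.Primes, Matrix.SpecialLinearGroup (Fin N) ℤ_[(p : ℕ)], x p = z →
          ∀ i : {i : ℕ // k ≤ i}, p = ⟨nthPrime i, (nthPrime_fact i).out⟩ →
            padicRed N k x i = y i := by
    intro p
    by_cases hp : ∃ i : {i : ℕ // k ≤ i}, p = ⟨nthPrime i, (nthPrime_fact i).out⟩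
    · obtain ⟨i, rfl⟩ := hp
      obtain ⟨z, hz⟩ := Matrix.SpecialLinearGroup.map_surjective_of_isLocalHom
        (ZMod.ringHom_surjective (PadicInt.toZMod : ℤ_[nthPrime i] →+* _)) (y i)
      refine ⟨z, fun h => absurd (nthPrime_mono i.2) (not_le.2 h), fun x hx j h => ?_⟩
      have hij : i = j := Subtype.ext (nthPrime_injOn (hk.trans i.2) (hk.trans j.2)
        (congrArg Subtype.val h))
      subst hij
      rw [padicRed, hx]
      exact hz
    · exact ⟨1, fun _ => rfl, fun _ _ i h => absurd ⟨i, h⟩ hp⟩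
  choose x hx1 hx2 using key
  exact ⟨x, hx1, funext fun i => hx2 _ x rfl i rfl⟩

theorem ContainsLargePrimes.denseRange {N k : ℕ} [NeZero N] (hk : 1 ≤ k) {G : Subgroup (SLZ N)}
    (hG : ContainsLargePrimes G k) : DenseRange ((redProd N k).comp G.subtype) := by
  intro y
  obtain ⟨x, hx, rfl⟩ := exists_padicRed_eq hk y
  have h1 := image_closure_subset_closure_image (continuous_padicRed N k)
    (Set.mem_image_of_mem _ (hG x hx))
  refine closure_mono ?_ h1
  rintro _ ⟨_, ⟨g, hg, rfl⟩, rfl⟩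
  exact ⟨⟨g, hg⟩, (padicRed_padicDiag N k g).symm⟩

theorem eq_one_of_redMod_eq_one {N n : ℕ} {g : SLZ N} (h : ∀ i, n ≤ i → redMod N i g = 1) :
    g = 1 := by
  ext a b
  rw [← sub_eq_zero]
  set c : ℤ := g a b - (1 : SLZ N) a b with hc
  -- As `nthPrime i ≥ i - 1 > |c|`, divisibility of the entry `c` of `g - 1` by this prime forces `c
  -- = 0`.
  let i := max n (c.natAbs + 2)
  have h1 : ((nthPrime i : ℕ) : ℤ) ∣ c := by
    rw [← ZMod.intCast_zmod_eq_zero_iff_dvd, hc, Int.cast_sub, sub_eq_zero]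
    have h2 := congrArg (fun m : SLmod N i => m.1 a b)
      ((h i (le_max_left _ _)).trans (map_one (redMod N i)).symm)
    exact h2
  apply Int.eq_zero_of_abs_lt_dvd h1
  rw [Int.abs_eq_natAbs]
  have h3 := le_nthPrime i
  have h4 : c.natAbs + 2 ≤ i := le_max_right _ _
  omega

end Reduction

/-! ## The product action -/

section Product

variable {N k : ℕ} {A : ∀ i, Subgroup (SLmod N i)}

/-- The points of `X` whose coordinates of index less than `n` are those of `x`. -/
def cylinderAt (x : ProductSpace k A) (n : ℕ) : Clopens (ProductSpace k A) where
  carrier := {y | ∀ i : {i : ℕ // k ≤ i}, (i : ℕ) < n → y i = x i}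
  isClopen' := by
    have hfin : {i : {i : ℕ // k ≤ i} | (i : ℕ) < n}.Finite :=
      (Set.finite_lt_nat n).preimage Subtype.val_injective.injOn
    have h : {y : ProductSpace k A | ∀ i : {i : ℕ // k ≤ i}, (i : ℕ) < n → y i = x i} =
        ⋂ i ∈ {i : {i : ℕ // k ≤ i} | (i : ℕ) < n}, (fun y => y i) ⁻¹' {x i} := by
      ext y; simp
    rw [h]
    exact hfin.isClopen_biInter fun i _ => (isClopen_discrete _).preimage (continuous_apply i)

theorem self_mem_cylinderAt (x : ProductSpace k A) (n : ℕ) : x ∈ cylinderAt x n :=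
  fun _ _ => rfl

theorem cylinderAt_anti (x : ProductSpace k A) {m n : ℕ} (h : m ≤ n) :
    cylinderAt x n ≤ cylinderAt x m :=
  fun _ hy i hi => hy i (hi.trans_le h)

theorem update_mem_cylinderAt (x : ProductSpace k A) {n : ℕ} {i : {i : ℕ // k ≤ i}}
    (hi : n ≤ (i : ℕ)) (q : SLmod N i ⧸ A i) : Function.update x i q ∈ cylinderAt x n := by
  intro j hj
  apply Function.update_of_ne
  rintro rfl
  omega

theorem exists_cylinderAt_subset {W : Set (ProductSpace k A)} (hW : IsOpen W)
    {x : ProductSpace k A} (hx : x ∈ W) : ∃ n, (cylinderAt x n : Set (ProductSpace k A)) ⊆ W := by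
  obtain ⟨I, u, hu, huW⟩ := isOpen_pi_iff.1 hW x hx
  refine ⟨I.sup (fun i => (i : ℕ)) + 1, fun y hy => huW fun i hi => ?_⟩
  rw [hy i (Nat.lt_succ_of_le (Finset.le_sup (f := fun i : {i : ℕ // k ≤ i} => (i : ℕ)) hi))]
  exact (hu i hi).2

theorem iInter_cylinderAt (x : ProductSpace k A) :
    ⋂ j, (cylinderAt x (k + j) : Set (ProductSpace k A)) = {x} := by
  ext y
  rw [Set.mem_iInter, Set.mem_singleton_iff]
  refine ⟨fun h => funext fun i => h (i + 1) i (by omega), ?_⟩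
  rintro rfl j
  exact self_mem_cylinderAt _ _

/-- If one point of the cylinder stays in it, then `γ i` fixes `x i` for all `i < n`, a condition
independent of the point. -/
theorem isBlockSet_cylinderAt (x : ProductSpace k A) (n : ℕ) :
    IsBlockSet (ModProduct N k) (cylinderAt x n) := by
  intro γ y hy hγy z
  have hγ : ∀ i : {i : ℕ // k ≤ i}, (i : ℕ) < n → γ i • x i = x i := fun i hi => by
    have := hγy i hi
    rwa [Pi.smul_apply', hy i hi] at this
  refine forall₂_congr fun i hi => ?_
  rw [Pi.smul_apply']
  conv_lhs => rw [← hγ i hi]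
  exact smul_left_cancel_iff _

theorem smul_eq_self_of_tail_eq_one {x : ProductSpace k A} {n : ℕ} {γ : ModProduct N k}
    (hγ : γ ∈ MulAction.stabilizer (ModProduct N k) x)
    (h : ∀ i : {i : ℕ // k ≤ i}, n ≤ (i : ℕ) → γ i = 1) {u : ProductSpace k A}
    (hu : u ∈ cylinderAt x n) : γ • u = u := by
  funext i
  rw [Pi.smul_apply']
  rcases lt_or_ge (i : ℕ) n with hi | hi
  · rw [hu i hi]
    exact congrFun (MulAction.mem_stabilizer_iff.1 hγ) i
  · rw [h i hi, one_smul]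

/-- The normal core is the kernel of the action on cosets. -/
theorem eq_one_of_forall_smul_eq {H : Type*} [Group H] {B : Subgroup H} (hB : B.normalCore = ⊥)
    {a : H} (h : ∀ q : H ⧸ B, a • q = q) : a = 1 := by
  rw [← Subgroup.mem_bot, ← hB, Subgroup.normalCore_eq_ker, MonoidHom.mem_ker]
  ext q
  exact h q

/-- Coordinate `i ≥ n` varies freely within the cylinder, so `γ i` fixes every coset of `A i`. -/
theorem tail_eq_one_of_smul_eq_self (hcore : ∀ i, k ≤ i → (A i).normalCore = ⊥)
    {x : ProductSpace k A} {n : ℕ} {γ : ModProduct N k} (h : ∀ u ∈ cylinderAt x n, γ • u = u)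
    (i : {i : ℕ // k ≤ i}) (hi : n ≤ (i : ℕ)) : γ i = 1 := by
  refine eq_one_of_forall_smul_eq (hcore i i.2) fun q => ?_
  have := congrFun (h _ (update_mem_cylinderAt x hi q)) i
  rwa [Pi.smul_apply', Function.update_self] at this

/-- Topological freeness holds for integral matrices, which are determined by their reductions at
large primes. It fails for the whole of `Γ`, and that failure is the source of wildness. -/
theorem redProd_eq_one_of_open (hcore : ∀ i, k ≤ i → (A i).normalCore = ⊥) (g : SLZ N)
    (W : Set (ProductSpace k A)) (hW : IsOpen W) (hne : W.Nonempty)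
    (h : ∀ w ∈ W, redProd N k g • w = w) : redProd N k g = 1 := by
  obtain ⟨w, hw⟩ := hne
  obtain ⟨n, hn⟩ := exists_cylinderAt_subset hW hw
  have hg : g = 1 := eq_one_of_redMod_eq_one (n := max n k) fun i hi =>
    tail_eq_one_of_smul_eq_self hcore (fun u hu => h u (hn hu)) ⟨i, (le_max_right _ _).trans hi⟩
      ((le_max_left _ _).trans hi)
  rw [hg, map_one]

theorem exists_quotient_ne {H : Type*} [Group H] {B : Subgroup H} (hB : B.normalCore = ⊥)
    (hB' : B ≠ ⊥) (q : H ⧸ B) : ∃ q' : H ⧸ B, q' ≠ q := by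
  by_contra! hq
  apply hB'
  rw [Subgroup.eq_bot_iff_forall]
  intro a _
  exact eq_one_of_forall_smul_eq hB fun r => (hq _).trans (hq r).symm

/-! ### Cantor property, minimality and wildness. -/

theorem isCantorSpace_productSpace (hA : ∀ i, k ≤ i → A i ≠ ⊥)
    (hcore : ∀ i, k ≤ i → (A i).normalCore = ⊥) : IsCantorSpace (ProductSpace k A) := by
  refine ⟨⟨basePoint k A⟩, inferInstance, inferInstance, inferInstance, ?_⟩
  rw [perfectSpace_iff_forall_not_isolated]
  intro x
  rw [← mem_closure_iff_nhdsWithin_neBot, mem_closure_iff]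
  intro W hW hx
  obtain ⟨n, hn⟩ := exists_cylinderAt_subset hW hx
  let i : {i : ℕ // k ≤ i} := ⟨max n k, le_max_right _ _⟩
  obtain ⟨q, hq⟩ := exists_quotient_ne (hcore i i.2) (hA i i.2) (x i)
  refine ⟨Function.update x i q, hn (update_mem_cylinderAt x (le_max_left _ _) q), fun h => hq ?_⟩
  rw [← congrFun h i, Function.update_self]

theorem isMinimalAction_of_denseRange {G : Type*} [Group G]
    {Φ : G →* (ProductSpace k A ≃ₜ ProductSpace k A)} {ρ : G →* ModProduct N k} (hΦ : ∀ g x, Φ g x = ρ g • x) (hρ : DenseRange ρ) :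
    IsMinimalAction Φ := by
  intro x
  have hs : Function.Surjective fun γ : ModProduct N k => γ • x := by
    intro y
    choose γ hγ using fun i : {i : ℕ // k ≤ i} =>
      MulAction.exists_smul_eq (SLmod N i) (x i) (y i)
    exact ⟨γ, funext hγ⟩
  have := hs.denseRange.comp hρ (by fun_prop : Continuous fun γ : ModProduct N k => γ • x)
  have he : (fun g => Φ g x) = (fun γ : ModProduct N k => γ • x) ∘ ρ := funext fun g => hΦ g x
  rw [he]
  exact this

/-- An element of `A_i`, placed in the coordinate `i`, fixes `x_0`. -/
theorem mulSingle_mem_stabilizer {i : {i : ℕ // k ≤ i}} {a : SLmod N i} (ha : a ∈ A i) :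
    (Pi.mulSingle i a : ModProduct N k) ∈
      MulAction.stabilizer (ModProduct N k) (basePoint k A) := by
  rw [MulAction.mem_stabilizer_iff]
  funext j
  rw [Pi.smul_apply']
  rcases eq_or_ne j i with rfl | hj
  · rw [Pi.mulSingle_eq_same]
    change ((a • 1 : SLmod N j) : SLmod N j ⧸ A j) = ((1 : SLmod N j) : SLmod N j ⧸ A j)
    rw [QuotientGroup.eq]
    simpa using ha
  · rw [Pi.mulSingle_eq_of_ne hj, one_smul]

theorem isWildAction_of_denseRange (hA : ∀ i, k ≤ i → A i ≠ ⊥)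
    (hcore : ∀ i, k ≤ i → (A i).normalCore = ⊥) {G : Type*} [Group G]
    {Φ : G →* (ProductSpace k A ≃ₜ ProductSpace k A)} {ρ : G →* ModProduct N k}
    (hΦ : ∀ g x, Φ g x = ρ g • x) (hρ : DenseRange ρ)
    (hfree : ∀ (g : G) (W : Set (ProductSpace k A)), IsOpen W → W.Nonempty →
      (∀ w ∈ W, ρ g • w = w) → ρ g = 1) : IsWildAction Φ := by
  intro hst
  obtain ⟨U, hxU, hUa, hU⟩ := hst (basePoint k A)
  have hUb := hUa.isBlockSet hΦ hρ hfree
  obtain ⟨n, hn⟩ := exists_cylinderAt_subset U.isClopen.isOpen hxU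
  let i : {i : ℕ // k ≤ i} := ⟨max n k, le_max_right _ _⟩
  have hni : n ≤ (i : ℕ) := le_max_left _ _
  obtain ⟨a, ha, ha1⟩ := (A i).bot_or_exists_ne_one.resolve_left (hA i i.2)
  have hγ := mulSingle_mem_stabilizer (k := k) (A := A) (i := i) ha
  set γ : ModProduct N k := Pi.mulSingle i a with hγdef
  -- Level `i + 1` freezes coordinate `i`, so `γ` is the identity on `V`, while coordinate `i` is
  -- still free in the cylinder of level `n` inside `U`.
  let V := cylinderAt (basePoint k A) (i + 1)
  have hVb : IsBlockSet (ModProduct N k) V := isBlockSet_cylinderAt _ _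
  have hxV : basePoint k A ∈ V := self_mem_cylinderAt _ _
  have hγU := hUb.stabilizer_le hxU hγ
  have hγV := hVb.stabilizer_le hxV hγ
  have hV : V ≤ U := fun y hy => hn (cylinderAt_anti _ (hni.trans (Nat.le_succ _)) hy)
  have h1 := hU V hV (hVb.isAdapted hΦ ⟨_, hxV⟩) (restrictHom U ⟨γ, hγU⟩)
    -- Approximating `γ` inside the open stabilizer of `V` places it in the closure of `𝓗_{U,V}`,
    -- not merely of `𝓗_U`.
    (restrictHom_mem_closure (S := (inducedStabilizer Φ U V : Set (U ≃ₜ U))) hρ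
      (isOpen_setStab V) (fun g hg hgV => ⟨⟨g, fun u => (hΦ g u).symm⟩, fun u => hgV u⟩) _ hγV)
    (fun u hu => Subtype.ext (smul_eq_self_of_tail_eq_one hγ (fun j hj => by
      apply Pi.mulSingle_eq_of_ne
      rintro rfl
      omega) hu))
  rw [restrictHom_eq_one_iff] at h1
  have h2 : γ i = 1 := tail_eq_one_of_smul_eq_self hcore (fun u hu => h1 u (hn hu)) i hni
  rw [hγdef, Pi.mulSingle_eq_same] at h2
  exact ha1 h2

/-- The point of `X` with coordinates `c_i A_i`. -/
noncomputable abbrev cosetPoint (A : ∀ i, Subgroup (SLmod N i)) (c : ModProduct N k) : ProductSpace k A :=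
  fun i => (c i : SLmod N i ⧸ A i)

theorem mem_stabilizer_cosetPoint {c γ : ModProduct N k} :
    γ ∈ MulAction.stabilizer (ModProduct N k) (cosetPoint A c) ↔
      ∀ i : {i : ℕ // k ≤ i}, (c i)⁻¹ * γ i * c i ∈ A i := by
  rw [MulAction.mem_stabilizer_iff, funext_iff]
  refine forall_congr' fun i => ?_
  rw [eq_comm]
  change ((c i : SLmod N i) : SLmod N i ⧸ A i) = ((γ i • c i : SLmod N i) : SLmod N i ⧸ A i) ↔ _
  rw [QuotientGroup.eq, smul_eq_mul, mul_assoc]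

/-- The conjugation of the isotropy group of `(c_i A_i)_i` to `∏ A_i`, followed by the projection to
the coordinates of index at least `n`. -/
noncomputable def isotropyProj (A : ∀ i, Subgroup (SLmod N i)) (c : ModProduct N k) {n : ℕ} (hn : k ≤ n) :
    MulAction.stabilizer (ModProduct N k) (cosetPoint A c) →* DiscProduct A n where
  toFun γ i := ⟨(c ⟨i, hn.trans i.2⟩)⁻¹ * γ.1 ⟨i, hn.trans i.2⟩ * c ⟨i, hn.trans i.2⟩,
    mem_stabilizer_cosetPoint.1 γ.2 ⟨i, hn.trans i.2⟩⟩
  map_one' := by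
    funext i
    apply Subtype.ext
    simp
  map_mul' γ δ := by
    funext i
    apply Subtype.ext
    simp [mul_assoc]

theorem isotropyProj_apply {c : ModProduct N k} {n : ℕ} (hn : k ≤ n)
    (γ : MulAction.stabilizer (ModProduct N k) (cosetPoint A c)) (i : {i : ℕ // n ≤ i}) :
    (isotropyProj A c hn γ i : SLmod N i) =
      (c ⟨i, hn.trans i.2⟩)⁻¹ * γ.1 ⟨i, hn.trans i.2⟩ * c ⟨i, hn.trans i.2⟩ := rfl

theorem mem_ker_isotropyProj {c : ModProduct N k} {n : ℕ} (hn : k ≤ n)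
    {γ : MulAction.stabilizer (ModProduct N k) (cosetPoint A c)} :
    γ ∈ (isotropyProj A c hn).ker ↔ ∀ i : {i : ℕ // k ≤ i}, n ≤ (i : ℕ) → γ.1 i = 1 := by
  have key : ∀ i : {i : ℕ // n ≤ i}, isotropyProj A c hn γ i = 1 ↔
      γ.1 ⟨i, hn.trans i.2⟩ = 1 := fun i => by
    rw [Subtype.ext_iff, isotropyProj_apply, OneMemClass.coe_one, mul_assoc, inv_mul_eq_one,
      eq_comm, mul_eq_right]
  rw [MonoidHom.mem_ker, funext_iff]
  exact ⟨fun h i hi => (key ⟨i, hi⟩).1 (h ⟨i, hi⟩), fun h i => (key i).2 (h _ i.2)⟩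

theorem isotropyProj_surjective (c : ModProduct N k) {n : ℕ} (hn : k ≤ n) :
    Function.Surjective (isotropyProj A c hn) := by
  intro d
  refine ⟨⟨fun i => if h : n ≤ (i : ℕ) then c i * d ⟨i, h⟩ * (c i)⁻¹ else 1,
    mem_stabilizer_cosetPoint.2 fun i => ?_⟩, ?_⟩
  · split_ifs with h
    · simp [mul_assoc]
    · simp
  · funext i
    apply Subtype.ext
    rw [isotropyProj_apply]
    dsimp only
    rw [dif_pos i.2]
    simp [mul_assoc]

/-- The inclusion of `∏_{i ≥ n} A_i` in the isotropy group of `x_0`. -/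
noncomputable def isotropySection (k : ℕ) (A : ∀ i, Subgroup (SLmod N i)) (n : ℕ) :
    DiscProduct A n →* MulAction.stabilizer (ModProduct N k) (basePoint k A) where
  toFun d := ⟨fun i => if h : n ≤ (i : ℕ) then d ⟨i, h⟩ else 1,
    (mem_stabilizer_cosetPoint (c := 1)).2 fun i => by
      split_ifs with h
      · simp
      · simp⟩
  map_one' := by
    apply Subtype.ext
    funext i
    simp
  map_mul' d d' := by
    apply Subtype.ext
    funext i
    simp only [Subgroup.coe_mul, Pi.mul_apply]
    split_ifs <;> simp

theorem isotropySection_apply (n : ℕ) (d : DiscProduct A n) (i : {i : ℕ // k ≤ i}) :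
    (isotropySection k A n d).1 i = if h : n ≤ (i : ℕ) then (d ⟨i, h⟩ : SLmod N i) else 1 := rfl

theorem continuous_isotropySection (n : ℕ) : Continuous (isotropySection k A n) := by
  refine Continuous.subtype_mk (continuous_pi fun i => ?_) _
  split_ifs with h
  · exact continuous_subtype_val.comp (continuous_apply _)
  · exact continuous_const

theorem isBlockSet_cylinder (k : ℕ) (A : ∀ i, Subgroup (SLmod N i)) (n : ℕ) :
    IsBlockSet (ModProduct N k) (cylinder k A n) :=
  isBlockSet_cylinderAt (basePoint k A) n

/-! ### The discriminant groups of the cylinders `U_n`. -/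

section Discriminant

variable {G : Type*} [Group G] {Φ : G →* (ProductSpace k A ≃ₜ ProductSpace k A)}
  {ρ : G →* ModProduct N k} (hΦ : ∀ g x, Φ g x = ρ g • x) (hρ : DenseRange ρ)

/-- The action of `∏_{i ≥ n} A_i` on `U_n`. -/
noncomputable def discProductHom (n : ℕ) : DiscProduct A n →*
    discriminantGroup Φ (cylinder k A n) (basePoint k A) (basePoint_mem_cylinder k A n) :=
  (isotropyHom hΦ hρ (isBlockSet_cylinder k A n)
    (basePoint_mem_cylinder k A n)).comp (isotropySection k A n)

/-- Injectivity is the triviality of the cores. For surjectivity, the coordinates of an isotropy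
element below `n` act on `U_n` only at the fixed coset `e A_i`, so they can be replaced by `1`. -/
theorem discProductHom_bijective (hcore : ∀ i, k ≤ i → (A i).normalCore = ⊥) {n : ℕ}
    (hn : k ≤ n) : Function.Bijective (discProductHom hΦ hρ n) := by
  constructor
  · rw [injective_iff_map_eq_one]
    intro d hd
    have h1 := (mem_ker_isotropyHom hΦ hρ (isBlockSet_cylinder k A n)
      (basePoint_mem_cylinder k A n)).1 hd
    funext i
    have h2 := tail_eq_one_of_smul_eq_self hcore h1 ⟨i, hn.trans i.2⟩ i.2
    rw [isotropySection_apply, dif_pos i.2] at h2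
    exact Subtype.ext h2
  · intro h
    obtain ⟨γ, rfl⟩ := isotropyHom_surjective hΦ hρ (isBlockSet_cylinder k A n)
      (basePoint_mem_cylinder k A n) h
    refine ⟨isotropyProj A 1 hn γ, (isotropyHom_eq_iff hΦ hρ _ _).2 fun u hu => ?_⟩
    funext i
    rw [Pi.smul_apply', Pi.smul_apply', isotropySection_apply]
    split_ifs with hi
    · congr 1
      refine (isotropyProj_apply (c := 1) hn γ ⟨i, hi⟩).trans ?_
      simp
    · rw [hu i (not_le.1 hi), one_smul]
      exact (congrFun (MulAction.mem_stabilizer_iff.1 γ.2) i).symm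

/-- The discriminant group of `U_n` at `x_0` is `∏_{i ≥ n} A_i`. -/
noncomputable def discriminantEquiv (hcore : ∀ i, k ≤ i → (A i).normalCore = ⊥) {n : ℕ}
    (hn : k ≤ n) :
    discriminantGroup Φ (cylinder k A n) (basePoint k A) (basePoint_mem_cylinder k A n) ≃ₜ*
      DiscProduct A n :=
  let f := MulEquiv.ofBijective (discProductHom hΦ hρ n) (discProductHom_bijective hΦ hρ hcore hn)
  have hf : Continuous f :=
    (continuous_isotropyHom hΦ hρ (isBlockSet_cylinder k A n)
      (basePoint_mem_cylinder k A n)).comp (continuous_isotropySection n)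
  { f.symm with
    -- A continuous bijection from the compact group `∏ A_i` to a Hausdorff group has continuous
    -- inverse.
    continuous_toFun := hf.homeoOfEquivCompactToT2 (f := f.toEquiv).symm.continuous
    continuous_invFun := hf }

theorem discriminantEquiv_symm_apply (hcore : ∀ i, k ≤ i → (A i).normalCore = ⊥) {n : ℕ}
    (hn : k ≤ n) (d : DiscProduct A n) :
    (discriminantEquiv hΦ hρ hcore hn).symm d = discProductHom hΦ hρ n d := rfl

theorem exists_restrictionMap_cylinder (hcore : ∀ i, k ≤ i → (A i).normalCore = ⊥) {n : ℕ}
    (hn : k ≤ n) :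
    ∃ σ : discriminantGroup Φ (cylinder k A n) (basePoint k A) (basePoint_mem_cylinder k A n) →*
        discriminantGroup Φ (cylinder k A (n + 1)) (basePoint k A)
          (basePoint_mem_cylinder k A (n + 1)),
      IsRestrictionMap Φ (cylinder_succ_le k A n) (basePoint k A)
        (basePoint_mem_cylinder k A (n + 1)) σ ∧
      Function.Surjective σ ∧
      (∀ h, discriminantEquiv hΦ hρ hcore (hn.trans n.le_succ) (σ h) =
        discProj A n (discriminantEquiv hΦ hρ hcore hn h)) ∧
      Nonempty (σ.ker ≃* A n) := by
  obtain ⟨σ, hσ, hσ'⟩ := exists_restrictionMap hΦ hρ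
    (isBlockSet_cylinder k A n) (isBlockSet_cylinder k A (n + 1))
    (cylinder_succ_le k A n) (basePoint_mem_cylinder k A (n + 1))
  have hproj : ∀ h, discriminantEquiv hΦ hρ hcore (hn.trans n.le_succ) (σ h) =
      discProj A n (discriminantEquiv hΦ hρ hcore hn h) := by
    intro h
    obtain ⟨d, rfl⟩ := (discriminantEquiv hΦ hρ hcore hn).symm.surjective h
    apply (discriminantEquiv hΦ hρ hcore (hn.trans n.le_succ)).symm.injective
    rw [ContinuousMulEquiv.apply_symm_apply, ContinuousMulEquiv.symm_apply_apply,
      discriminantEquiv_symm_apply, discriminantEquiv_symm_apply]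
    refine (hσ' _).trans ((isotropyHom_eq_iff hΦ hρ _ _).2 fun u hu => ?_)
    funext i
    rw [Pi.smul_apply', Pi.smul_apply', isotropySection_apply, isotropySection_apply]
    rcases lt_or_ge (i : ℕ) (n + 1) with hi | hi
    · rw [dif_neg (not_le.2 hi), one_smul, hu i hi]
      exact congrFun (MulAction.mem_stabilizer_iff.1 (isotropySection k A n d).2) i
    · rw [dif_pos hi, dif_pos (n.le_succ.trans hi)]
      rfl
  refine ⟨σ, hσ, fun h => ?_, hproj, ⟨MulEquiv.ofBijective
    (((Pi.evalMonoidHom (fun i : {i : ℕ // n ≤ i} => A i) ⟨n, le_rfl⟩).comp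
      (discriminantEquiv hΦ hρ hcore hn).toMulEquiv.toMonoidHom).comp σ.ker.subtype) ⟨?_, ?_⟩⟩⟩
  · obtain ⟨γ, rfl⟩ := isotropyHom_surjective hΦ hρ (isBlockSet_cylinder k A (n + 1))
      (basePoint_mem_cylinder k A (n + 1)) h
    exact ⟨_, hσ' γ⟩
  · rw [injective_iff_map_eq_one]
    rintro ⟨h, hh⟩ h1
    apply Subtype.ext
    apply (discriminantEquiv hΦ hρ hcore hn).injective
    rw [OneMemClass.coe_one, map_one]
    have h2 := hproj h
    rw [MonoidHom.mem_ker.1 hh, map_one] at h2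
    funext ⟨i, hi⟩
    -- The kernel of the projection sees only coordinate `n`, where `h1` applies; the later
    -- coordinates vanish by `h2`.
    rcases hi.eq_or_lt with rfl | hi'
    · exact h1
    · exact (congrFun h2 ⟨i, hi'⟩).symm
  · intro a
    refine ⟨⟨(discriminantEquiv hΦ hρ hcore hn).symm (Pi.mulSingle ⟨n, le_rfl⟩ a), ?_⟩, ?_⟩
    · rw [MonoidHom.mem_ker]
      apply (discriminantEquiv hΦ hρ hcore (hn.trans n.le_succ)).injective
      rw [hproj, map_one, ContinuousMulEquiv.apply_symm_apply]
      funext i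
      have hne : (⟨i, n.le_succ.trans i.2⟩ : {i : ℕ // n ≤ i}) ≠ ⟨n, le_rfl⟩ := fun h => by
        have := congrArg Subtype.val h
        have := i.2
        simp only at *
        omega
      exact Pi.mulSingle_eq_of_ne (M := fun i : {i : ℕ // n ≤ i} => A i) hne a
    · change (discriminantEquiv hΦ hρ hcore hn)
        ((discriminantEquiv hΦ hρ hcore hn).symm (Pi.mulSingle ⟨n, le_rfl⟩ a)) ⟨n, le_rfl⟩ = a
      rw [ContinuousMulEquiv.apply_symm_apply, Pi.mulSingle_eq_same]

end Discriminant

/-- The adapted neighbourhood basis of cylinders at `x`. -/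
def cylinderBasis {G : Type*} [Group G] {Φ : G →* (ProductSpace k A ≃ₜ ProductSpace k A)}
    {ρ : G →* ModProduct N k} (hΦ : ∀ g x, Φ g x = ρ g • x) (x : ProductSpace k A) :
    AdaptedBasis Φ x where
  set j := cylinderAt x (k + j)
  mem _ := self_mem_cylinderAt _ _
  succ_le j := cylinderAt_anti _ (Nat.le_succ (k + j))
  inter_eq := iInter_cylinderAt x
  adapted _ := (isBlockSet_cylinderAt _ _).isAdapted hΦ ⟨x, self_mem_cylinderAt _ _⟩

/-- A descending chain of compact sets with intersection `{x}` eventually enters any neighbourhood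
of `x`. -/
theorem AdaptedBasis.exists_subset_cylinderAt {G : Type*} [Group G]
    {Φ : G →* (ProductSpace k A ≃ₜ ProductSpace k A)} {x : ProductSpace k A}
    (𝒰 : AdaptedBasis Φ x) (n : ℕ) : ∃ j, 𝒰.set j ≤ cylinderAt x n := by
  have hanti : Antitone fun j => (𝒰.set j : Set (ProductSpace k A)) :=
    antitone_nat_of_succ_le fun j => 𝒰.succ_le j
  refine exists_subset_nhds_of_isCompact' (V := fun j => (𝒰.set j : Set (ProductSpace k A)))
    hanti.directed_ge (fun j => (𝒰.set j).isClopen.isClosed.isCompact)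
    (fun j => (𝒰.set j).isClopen.isClosed) fun y hy => ?_
  rw [𝒰.inter_eq, Set.mem_singleton_iff] at hy
  subst hy
  exact (cylinderAt y n).isClopen.isOpen.mem_nhds (self_mem_cylinderAt y n)

theorem hasAsymptoticDiscriminant_of_denseRange (hcore : ∀ i, k ≤ i → (A i).normalCore = ⊥)
    {G : Type} [Group G] {Φ : G →* (ProductSpace k A ≃ₜ ProductSpace k A)}
    {ρ : G →* ModProduct N k} (hΦ : ∀ g x, Φ g x = ρ g • x) (hρ : DenseRange ρ)
    (hfree : ∀ (g : G) (W : Set (ProductSpace k A)), IsOpen W → W.Nonempty →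
      (∀ w ∈ W, ρ g • w = w) → ρ g = 1) :
    HasAsymptoticDiscriminant Φ (fun j => discProj A (k + j)) := by
  refine ⟨fun x => ⟨cylinderBasis hΦ x⟩, fun x 𝒰 => ?_⟩
  -- Coset representatives of `x` conjugate its isotropy group to `∏ A_i`, so every point is handled
  -- like `x_0`.
  obtain ⟨c, rfl⟩ : ∃ c : ModProduct N k, cosetPoint A c = x := by
    choose c hc using fun i => QuotientGroup.mk_surjective (x i)
    exact ⟨c, funext hc⟩
  have hb : ∀ j, IsBlockSet (ModProduct N k) (𝒰.set j) := fun j =>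
    (𝒰.adapted j).isBlockSet hΦ hρ hfree
  choose σ hσ hσ' using fun j =>
    exists_restrictionMap hΦ hρ (hb j) (hb (j + 1)) (𝒰.succ_le j) (𝒰.mem (j + 1))
  refine ⟨σ, hσ, tailEquivalent_of_ker (α := fun j => isotropyHom hΦ hρ (hb j) (𝒰.mem j))
    (β := fun j => isotropyProj A c (Nat.le_add_right k j))
    (fun j => isotropyHom_surjective hΦ hρ _ _) (fun j => isotropyProj_surjective c _)
    hσ' (fun _ _ => rfl) (fun j => ?_) (fun m => ?_)⟩
  · obtain ⟨n, hn⟩ := exists_cylinderAt_subset (𝒰.set j).isClopen.isOpen (𝒰.mem j)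
    -- Index `n` of the second sequence stands for cylinder level `k + n`, which is at least `n`.
    refine ⟨n, fun γ hγ => ?_⟩
    rw [mem_ker_isotropyHom] at hγ
    rw [mem_ker_isotropyProj]
    exact tail_eq_one_of_smul_eq_self hcore fun u hu =>
      hγ u (hn (cylinderAt_anti _ (Nat.le_add_left n k) hu))
  · obtain ⟨j, hj⟩ := 𝒰.exists_subset_cylinderAt (k + m)
    refine ⟨j, fun γ hγ => ?_⟩
    rw [mem_ker_isotropyProj] at hγ
    rw [mem_ker_isotropyHom]
    exact fun u hu => smul_eq_self_of_tail_eq_one γ.2 hγ (hj hu)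

end Product

theorem proposition8p2 (N : ℕ) (hN : 3 ≤ N)
    (G : Subgroup (SLZ N)) (hGfin : G.FiniteIndex)
    (hGtf : ∀ g ∈ G, g ≠ 1 → ¬ IsOfFinOrder g)
    (k : ℕ) (hk : 2 ≤ k) (hGk : ContainsLargePrimes G k)
    (A : ∀ i, Subgroup (SLmod N i))
    (hA : ∀ i, k ≤ i → A i ≠ ⊥)
    (hcore : ∀ i, k ≤ i → (A i).normalCore = ⊥)
    (Φ : G →* (ProductSpace k A ≃ₜ ProductSpace k A))
    (hΦ : Φ = (productAction k A).comp G.subtype) :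
    -- an equicontinuous minimal Cantor action
    IsCantorSpace (ProductSpace k A) ∧ IsMinimalAction Φ ∧ IsEquicontinuousAction Φ ∧
    -- which is wild
    IsWildAction Φ ∧
    -- the discriminant groups of the restricted actions on `U_n`, and the maps between them
    (∃ 𝒰 : AdaptedBasis Φ (basePoint k A), ∀ j, 𝒰.set j = cylinder k A (k + j)) ∧
    (∃ e : ∀ n, k ≤ n →
        (discriminantGroup Φ (cylinder k A n) (basePoint k A) (basePoint_mem_cylinder k A n) ≃ₜ*
          DiscProduct A n),
      (∀ n (hn : k ≤ n) (d : DiscProduct A n) (u : cylinder k A n) (i : {i : ℕ // k ≤ i}),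
        ((((e n hn).symm d : cylinder k A n ≃ₜ cylinder k A n) u : cylinder k A n) :
            ProductSpace k A) i =
          if h : n ≤ (i : ℕ) then (d ⟨i, h⟩ : SLmod N i) • (u : ProductSpace k A) i
          else (u : ProductSpace k A) i) ∧
      ∀ n (hn : k ≤ n),
        ∃ σ : discriminantGroup Φ (cylinder k A n) (basePoint k A)
              (basePoint_mem_cylinder k A n) →*
            discriminantGroup Φ (cylinder k A (n + 1)) (basePoint k A)
              (basePoint_mem_cylinder k A (n + 1)),
          IsRestrictionMap Φ (cylinder_succ_le k A n) (basePoint k A)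
            (basePoint_mem_cylinder k A (n + 1)) σ ∧
          Function.Surjective σ ∧
          (∀ h, e (n + 1) (hn.trans n.le_succ) (σ h) = discProj A n (e n hn h)) ∧
          Nonempty (σ.ker ≃* A n)) ∧
    -- the asymptotic discriminant
    HasAsymptoticDiscriminant Φ (fun j => discProj A (k + j)) := by
  have : NeZero N := ⟨by omega⟩
  let ρ : G →* ModProduct N k := (redProd N k).comp G.subtype
  have hρ : DenseRange ρ := hGk.denseRange (by omega)
  have hΦρ : ∀ g x, Φ g x = ρ g • x := fun g x => by rw [hΦ]; rfl
  have hfree : ∀ (g : G) (W : Set (ProductSpace k A)), IsOpen W → W.Nonempty →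
      (∀ w ∈ W, ρ g • w = w) → ρ g = 1 := fun g => redProd_eq_one_of_open hcore g
  refine ⟨isCantorSpace_productSpace hA hcore, isMinimalAction_of_denseRange hΦρ hρ,
    equicontinuous_of_compact hΦρ, isWildAction_of_denseRange hA hcore hΦρ hρ hfree,
    ⟨cylinderBasis hΦρ _, fun j => rfl⟩,
    ⟨fun n hn => discriminantEquiv hΦρ hρ hcore hn, fun n hn d u i => ?_,
      fun n hn => exists_restrictionMap_cylinder hΦρ hρ hcore hn⟩,
    hasAsymptoticDiscriminant_of_denseRange hcore hΦρ hρ hfree⟩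
  change (isotropySection k A n d).1 i • (u : ProductSpace k A) i = _
  rw [isotropySection_apply]
  split_ifs
  · rfl
  · exact one_smul _ _
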